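/- **Theorem.** Let $\sigma(z)=1/(1+e^{-z})$ and consider the following Bayesian contextual logistic bandit with $K$ actions and $T$ rounds. A parameter $\theta^\star$ is drawn from a prior $Q_1$ that is concentrated on a set $\Theta_1\subset\mathbb{R}^d$ with $\|\theta\|\le S$ for all $\theta\in\Theta_1$ (Euclidean norm). For every context $x\in\mathcal{X}$ and action $a\in[K]$, the loss is Bernoulli with mean $\ell(\theta,x,a)=\sigma(f_\theta(x,a))$ under parameter $\theta$, where the logit function $f_\theta(x,a)$ is measurable in $(\theta,x)$ and $\theta\mapsto f_\theta(x,a)$ is $C$-Lipschitz on $\Theta_1$, with the same constant $C\ge 0$ for all $x$ and $a$. In each round $t=1,\dots,T$, an adaptive adversary selects a context $X_t$, possibly using randomization and the history $\mathcal{F}_{t-1}=\sigma(X_1,A_1,L_1,\dots,X_{t-1},A_{t-1},L_{t-1})$, but not $\theta^\star$: given $\mathcal{F}_{t-1}$, $X_t$ is conditionally independent of $\theta^\star$. The agent plays an action $A_t\in[K]$ and observes the loss $L_t\in\{0,1\}$, whose conditional law given $\theta^\star,\mathcal{F}_{t-1},X_t,A_t$ is Bernoulli with parameter $\ell(\theta^\star,X_t,A_t)$.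 The agent follows Thompson sampling (TS): with $Q_t$ the posterior, i.e. the conditional distribution of $\theta^\star$ given $\mathcal{F}_{t-1}$, it draws $\theta_t$ whose conditional law given $\mathcal{F}_{t-1},X_t$ is $Q_t$, and plays $A_t\in\arg\min_{a}\ell(\theta_t,X_t,a)$ with arbitrary tie-breaking, where $(\theta_t,A_t)$ is conditionally independent of $\theta^\star$ given $\mathcal{F}_{t-1},X_t$. Let $A_t^\star\in\arg\min_{a}\ell(\theta^\star,X_t,a)$ be an optimal action of round $t$. Then the Bayesian regret of TS satisfies $$R_T=\mathbb{E}\Big[\sum_{t=1}^T\big(\ell(\theta^\star,X_t,A_t)-\ell(\theta^\star,X_t,A_t^\star)\big)\Big]\le\sqrt{2KT\big(d\log(2SCT+1)+1\big)} .$$ In particular, the bound does not depend on the smallest slope of the sigmoid. -/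

import Mathlib

open MeasureTheory ProbabilityTheory

noncomputable section

namespace LogisticBandit

variable {Ω 𝒳 : Type*} {d K : ℕ}

/-- Mean loss of action `a` in context `x` under parameter `θ` in the logistic bandit with logit
function `f`: the loss is Bernoulli with parameter `σ (f θ x a)`, where `σ z = 1 / (1 + exp (-z))`. -/
def meanLoss (f : EuclideanSpace ℝ (Fin d) → 𝒳 → Fin K → ℝ)
    (θ : EuclideanSpace ℝ (Fin d)) (x : 𝒳) (a : Fin K) : ℝ :=
  Real.sigmoid (f θ x a)

/-- `a` is an arg min of the mean loss in context `x` under parameter `θ`. -/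
def IsOptimalAction (f : EuclideanSpace ℝ (Fin d) → 𝒳 → Fin K → ℝ)
    (θ : EuclideanSpace ℝ (Fin d)) (x : 𝒳) (a : Fin K) : Prop :=
  ∀ b : Fin K, meanLoss f θ x a ≤ meanLoss f θ x b

/-- The contexts, actions and losses of the first `t` rounds. Rounds are numbered `0, 1, 2, …`, so
this is what has been observed when round `t` starts. The loss `1` is `true`, the loss `0` is
`false`. -/
def history (X : ℕ → Ω → 𝒳) (A : ℕ → Ω → Fin K) (L : ℕ → Ω → Bool) (t : ℕ) (ω : Ω) :
    Fin t → 𝒳 × Fin K × Bool :=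
  fun s => (X s ω, A s ω, L s ω)

/-- The sigma-algebra on `Ω` generated by a random variable. -/
abbrev sigmaGen {α : Type*} [MeasurableSpace α] (Z : Ω → α) : MeasurableSpace Ω :=
  MeasurableSpace.comap Z inferInstance

/-- The random variables `Y` and `W` are conditionally independent given `Z`: the conditional law
of `Y` given `(Z, W)` is the conditional law of `Y` given `Z`. -/
def CondIndepGiven [MeasurableSpace Ω] (P : Measure Ω) {α β γ : Type*} [MeasurableSpace α]
    [MeasurableSpace β] [MeasurableSpace γ] (Y : Ω → α) (W : Ω → β) (Z : Ω → γ) : Prop :=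
  ∀ B : Set α, MeasurableSet B →
    P⟦Y ⁻¹' B | sigmaGen (fun ω => (Z ω, W ω))⟧ =ᵐ[P] P⟦Y ⁻¹' B | sigmaGen Z⟧

/-- The posterior at the start of round `t`: the (regular) conditional distribution of the hidden
parameter `θs` given the history of the previous rounds. -/
def posterior [MeasurableSpace Ω] [MeasurableSpace 𝒳] (P : Measure Ω) [IsFiniteMeasure P]
    (θs : Ω → EuclideanSpace ℝ (Fin d)) (X : ℕ → Ω → 𝒳) (A : ℕ → Ω → Fin K) (L : ℕ → Ω → Bool)
    (t : ℕ) (ω : Ω) : Measure (EuclideanSpace ℝ (Fin d)) :=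
  condDistrib θs (history X A L t) P (history X A L t ω)

/-- The environment side of `T` rounds of a Bayesian contextual logistic bandit with prior `Q₁`,
logit function `f`, hidden parameter `θs`, contexts `X t`, actions `A t` and losses `L t`. -/
structure IsEnvironment [MeasurableSpace Ω] [MeasurableSpace 𝒳] (P : Measure Ω)
    (Q₁ : Measure (EuclideanSpace ℝ (Fin d)))
    (f : EuclideanSpace ℝ (Fin d) → 𝒳 → Fin K → ℝ) (T : ℕ)
    (θs : Ω → EuclideanSpace ℝ (Fin d)) (X : ℕ → Ω → 𝒳) (A : ℕ → Ω → Fin K)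
    (L : ℕ → Ω → Bool) : Prop where
  measurable_param : Measurable θs
  measurable_context : ∀ t < T, Measurable (X t)
  measurable_action : ∀ t < T, Measurable (A t)
  measurable_loss : ∀ t < T, Measurable (L t)
  /-- The hidden parameter is drawn from the prior. -/
  law_param : P.map θs = Q₁
  /-- The adversary chooses the context adaptively and possibly at random, on the basis of the
  history but without access to the hidden parameter. -/
  context : ∀ t < T, CondIndepGiven P (X t) θs (history X A L t)
  /-- Given the hidden parameter, the history, the context and the action, the loss is Bernoulli
  with parameter `meanLoss f θs X_t A_t`. -/
  loss : ∀ t < T,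
    P⟦L t ⁻¹' {true} | sigmaGen (fun ω => (θs ω, history X A L t ω, X t ω, A t ω))⟧
      =ᵐ[P] fun ω => meanLoss f (θs ω) (X t ω) (A t ω)

/-- The actions `A t` of the first `T` rounds are those of Thompson sampling, with posterior
samples `θ t`. Ties in the arg min may be broken in any way, also at random. -/
structure IsThompsonSampling [MeasurableSpace Ω] [MeasurableSpace 𝒳] (P : Measure Ω)
    [IsFiniteMeasure P] (f : EuclideanSpace ℝ (Fin d) → 𝒳 → Fin K → ℝ) (T : ℕ)
    (θs : Ω → EuclideanSpace ℝ (Fin d)) (X : ℕ → Ω → 𝒳) (A : ℕ → Ω → Fin K)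
    (L : ℕ → Ω → Bool) (θ : ℕ → Ω → EuclideanSpace ℝ (Fin d)) : Prop where
  measurable_sample : ∀ t < T, Measurable (θ t)
  /-- Given the history and the context, `θ t` is distributed according to the posterior. -/
  sample : ∀ t < T, ∀ B : Set (EuclideanSpace ℝ (Fin d)), MeasurableSet B →
    P⟦θ t ⁻¹' B | sigmaGen (fun ω => (history X A L t ω, X t ω))⟧
      =ᵐ[P] fun ω => (posterior P θs X A L t ω).real B
  /-- The agent has no access to the hidden parameter besides what it has observed. -/
  private_randomness : ∀ t < T,
    CondIndepGiven P (fun ω => (θ t ω, A t ω)) θs (fun ω => (history X A L t ω, X t ω))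
  /-- The action minimizes the mean loss for the sampled parameter in the current context. -/
  action : ∀ t < T, ∀ᵐ ω ∂P, IsOptimalAction f (θ t ω) (X t ω) (A t ω)

/-- The Bayesian regret over `T` rounds of the actions `A` against the actions `Astar`. -/
def bayesRegret [MeasurableSpace Ω] (P : Measure Ω)
    (f : EuclideanSpace ℝ (Fin d) → 𝒳 → Fin K → ℝ) (T : ℕ)
    (θs : Ω → EuclideanSpace ℝ (Fin d)) (X : ℕ → Ω → 𝒳) (A Astar : ℕ → Ω → Fin K) : ℝ :=
  ∫ ω, ∑ t ∈ Finset.range T,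
    (meanLoss f (θs ω) (X t ω) (A t ω) - meanLoss f (θs ω) (X t ω) (Astar t ω)) ∂P

end LogisticBandit

end

/-!
The proof compares Thompson sampling with a predictor of the losses that enters only the analysis.
Let `N` be a finite `ε`-net of `Θ₁`, made of points of `Θ₁`, with `ε = 1 / (C T)`; a volume argument
gives `|N| ≤ (2 S C T + 1) ^ d` (`exists_net_log_card_le`). Let `q t` be the predicted mean loss
(`netPredict`) of the Bayesian whose prior is uniform on `N`, and let
`Γ t = 𝔼 [(ℓ(θs, X t, A t) - q t) ^ 2]`.

*Prediction.* The excess log-loss of `q t` over the true parameter telescopes, because the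
predictive probabilities are ratios of successive mixture likelihoods. As `log σ` is `1`-Lipschitz,
the total is, pointwise, at most `log |N| + T C ε ≤ log |N| + 1` (`sum_log_sub_log_netPredict_le`).
This is where the slope of the sigmoid would enter, and it does not. By Pinsker's inequality for
Bernoulli distributions the mean excess log-loss of a round is at least `2 Γ t`; hence
`2 ∑ Γ t ≤ log |N| + 1` (`IsEnvironment.sum_sq_error_le`).

*Regret.* Given the history and the context, the sample `θ t` and the hidden parameter `θs` have
the same law (`map_param_eq_map_sample`), so the regret of a round is the mean of
`ℓ(θs, X t, A t) - ℓ(θ t, X t, A t)`. Both losses are compared to `q t`. For the first, the mean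
difference is at most the square root of `Γ t`. For the second, `A t` depends on `θ t`; but it is
independent of `θs` given the past, and Cauchy-Schwarz over the `K` actions bounds the mean
difference by the square root of `K * Γ t` (`integral_ind_mul_abs_le`). In both places the square
root is kept in its AM-GM form with a free parameter `c`, so that the regret of the round is at most
`(K + 1) / (2 c) + c Γ t` (`round_regret_le`). Summing, using `K + 1 ≤ 2 K` and optimizing over `c`
gives the theorem.
-/

noncomputable section

namespace LogisticBandit


/-! ### Scalar inequalities -/

theorem two_mul_sq_sub_le_bernoulli_kl_of_le {p q : ℝ} (hp : 0 < p) (hpq : p ≤ q) (hq : q < 1) :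
    2 * (p - q) ^ 2 ≤ p * (Real.log p - Real.log q)
      + (1 - p) * (Real.log (1 - p) - Real.log (1 - q)) := by
  let h : ℝ → ℝ := fun x => -(p * Real.log x) - (1 - p) * Real.log (1 - x) - 2 * (p - x) ^ 2
  have hd : ∀ x ∈ Set.Icc p q, HasDerivAt h ((x - p) * ((1 - 2 * x) ^ 2 / (x * (1 - x)))) x := by
    intro x hx
    have hx0 : 0 < x := hp.trans_le hx.1
    have hx1 : 0 < 1 - x := by linarith [hx.2]
    have h1 := (Real.hasDerivAt_log hx0.ne').const_mul p
    have h2 := (((hasDerivAt_id x).const_sub 1).log hx1.ne').const_mul (1 - p)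
    have h3 := ((((hasDerivAt_id x).const_sub p).pow 2)).const_mul 2
    have h4 := (h1.neg.sub h2).sub h3
    refine h4.congr_deriv ?_
    simp only [id_eq]
    field_simp
    ring
  have hmono : MonotoneOn h (Set.Icc p q) := by
    refine monotoneOn_of_deriv_nonneg (convex_Icc p q)
      (fun x hx => (hd x hx).continuousAt.continuousWithinAt)
      (fun x hx => (hd x (interior_subset hx)).differentiableAt.differentiableWithinAt) ?_
    intro x hx
    have hx' := interior_subset hx
    rw [(hd x hx').deriv]
    have hx0 : 0 < x := hp.trans_le hx'.1
    have hx1 : 0 < 1 - x := by linarith [hx'.2]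
    have := sub_nonneg.2 hx'.1
    positivity
  have := hmono (Set.left_mem_Icc.2 hpq) (Set.right_mem_Icc.2 hpq) hpq
  simp only [h, sub_self] at this
  nlinarith [this]

/-- Pinsker's inequality for two Bernoulli distributions. -/
theorem two_mul_sq_sub_le_bernoulli_kl {p q : ℝ} (hp : 0 < p) (hp' : p < 1) (hq : 0 < q)
    (hq' : q < 1) :
    2 * (p - q) ^ 2 ≤ p * (Real.log p - Real.log q)
      + (1 - p) * (Real.log (1 - p) - Real.log (1 - q)) := by
  rcases le_total p q with h | h
  · exact two_mul_sq_sub_le_bernoulli_kl_of_le hp h hq'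
  · have := two_mul_sq_sub_le_bernoulli_kl_of_le (p := 1 - p) (q := 1 - q) (by linarith)
      (by linarith) (by linarith)
    rw [sub_sub_cancel, sub_sub_cancel] at this
    nlinarith [this]

/-- The logarithm of the sigmoid is `1`-Lipschitz. -/
theorem sigmoid_le_exp_abs_sub_mul (u v : ℝ) :
    Real.sigmoid u ≤ Real.exp |u - v| * Real.sigmoid v := by
  rw [Real.sigmoid_def, Real.sigmoid_def, ← div_eq_mul_inv, inv_eq_one_div,
    div_le_div_iff₀ (by positivity) (by positivity), one_mul, mul_add, mul_one, ← Real.exp_add]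
  refine add_le_add (Real.one_le_exp (abs_nonneg _)) (Real.exp_le_exp.2 ?_)
  linarith [le_abs_self (u - v)]

/-- The AM-GM inequality in the form in which it replaces Cauchy-Schwarz. -/
theorem abs_le_inv_add_mul_sq {c : ℝ} (hc : 0 < c) (x : ℝ) :
    |x| ≤ 1 / (2 * c) + c / 2 * x ^ 2 := by
  have h : 1 / (2 * c) + c / 2 * x ^ 2 - |x| = (c * |x| - 1) ^ 2 / (2 * c) := by
    rw [← sq_abs x]; field_simp; ring
  have : 0 ≤ (c * |x| - 1) ^ 2 / (2 * c) := by positivity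
  linarith

/-! ### Finite nets -/

theorem card_le_of_isSeparated {d : ℕ} {S ε : ℝ} (hS : 0 ≤ S) (hε : 0 < ε)
    (s : Finset (EuclideanSpace ℝ (Fin d))) (hs : ∀ c ∈ s, ‖c‖ ≤ S)
    (h : ∀ c ∈ s, ∀ c' ∈ s, c ≠ c' → ε ≤ dist c c') :
    (s.card : ℝ) ≤ (2 * S / ε + 1) ^ d := by
  let μ : Measure (EuclideanSpace ℝ (Fin d)) := volume
  have hδ : 0 < ε / 2 := by positivity
  have hρ : 0 < S + ε / 2 := by positivity
  have hdisj : Set.Pairwise (s : Set (EuclideanSpace ℝ (Fin d)))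
      (Function.onFun Disjoint fun c => Metric.ball c (ε / 2)) := by
    intro c hc c' hc' hne
    apply Metric.ball_disjoint_ball
    linarith [h c hc c' hc' hne]
  have hsub : (⋃ c ∈ s, Metric.ball c (ε / 2)) ⊆ Metric.ball 0 (S + ε / 2) := by
    refine Set.iUnion₂_subset fun x hx => Metric.ball_subset_ball' ?_
    rw [dist_zero_right]
    linarith [hs x hx]
  have hvol : (s.card : ENNReal) * ENNReal.ofReal ((ε / 2) ^ d) * μ (Metric.ball 0 1) ≤
      ENNReal.ofReal ((S + ε / 2) ^ d) * μ (Metric.ball 0 1) := by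
    calc _ = μ (⋃ c ∈ s, Metric.ball c (ε / 2)) := by
          rw [measure_biUnion_finset hdisj fun c _ => measurableSet_ball]
          simp only [μ.addHaar_ball_of_pos _ hδ, finrank_euclideanSpace_fin, Finset.sum_const,
            nsmul_eq_mul, mul_assoc]
      _ ≤ μ (Metric.ball 0 (S + ε / 2)) := measure_mono hsub
      _ = _ := by rw [μ.addHaar_ball_of_pos _ hρ, finrank_euclideanSpace_fin]
  have hcard := (ENNReal.mul_le_mul_iff_left
    (Metric.measure_ball_pos μ 0 zero_lt_one).ne' measure_ball_lt_top.ne).1 hvol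
  have hcard' := ENNReal.toReal_le_of_le_ofReal (by positivity) hcard
  rw [ENNReal.toReal_mul, ENNReal.toReal_natCast, ENNReal.toReal_ofReal (by positivity)] at hcard'
  rw [← le_div_iff₀ (by positivity), ← div_pow] at hcard'
  have hratio : (S + ε / 2) / (ε / 2) = 2 * S / ε + 1 := by
    field_simp
  rwa [hratio] at hcard'

/-- A set in a ball of radius `S` has an `ε`-net, made of points of the set, of at most
`(2 S / ε + 1) ^ d` points: a maximal `ε`-separated subset. -/
theorem exists_finset_net {d : ℕ} {S ε : ℝ} (hS : 0 ≤ S) (hε : 0 < ε)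
    (Θ : Set (EuclideanSpace ℝ (Fin d))) (hΘ : ∀ θ ∈ Θ, ‖θ‖ ≤ S) :
    ∃ N : Finset (EuclideanSpace ℝ (Fin d)), (∀ c ∈ N, c ∈ Θ) ∧
      (∀ θ ∈ Θ, ∃ c ∈ N, dist θ c ≤ ε) ∧ (N.card : ℝ) ≤ (2 * S / ε + 1) ^ d := by
  have hsep : ∀ C : Set (EuclideanSpace ℝ (Fin d)), Metric.IsSeparated (ε.toNNReal : ENNReal) C →
      ∀ c ∈ C, ∀ c' ∈ C, c ≠ c' → ε ≤ dist c c' := by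
    intro C hC c hc c' hc' hne
    have : ENNReal.ofReal ε < edist c c' := hC hc hc' hne
    rw [edist_dist] at this
    exact ((ENNReal.ofReal_lt_ofReal_iff_of_nonneg hε.le).1 this).le
  have hfin : Metric.packingNumber ε.toNNReal Θ ≠ ⊤ := by
    refine ne_top_of_le_ne_top (ENat.natCast_ne_top ⌊(2 * S / ε + 1) ^ d⌋₊) ?_
    refine iSup_le fun C => iSup_le fun hCΘ => iSup_le fun hC => ?_
    by_contra! hlt
    obtain ⟨D, hDC, hD⟩ := Set.exists_subset_encard_eq (Order.add_one_le_of_lt hlt)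
    have hDfin : D.Finite := Set.finite_of_encard_eq_coe (k := ⌊(2 * S / ε + 1) ^ d⌋₊ + 1) hD
    have hle := card_le_of_isSeparated hS hε hDfin.toFinset
      (fun c hc => hΘ c (hCΘ (hDC (hDfin.mem_toFinset.1 hc))))
      (fun c hc c' hc' => hsep C hC c (hDC (hDfin.mem_toFinset.1 hc)) c'
        (hDC (hDfin.mem_toFinset.1 hc')))
    have hcard : hDfin.toFinset.card = ⌊(2 * S / ε + 1) ^ d⌋₊ + 1 := by
      rw [hDfin.encard_eq_coe_toFinset_card] at hD
      exact_mod_cast hD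
    rw [hcard] at hle
    push_cast at hle
    linarith [Nat.lt_floor_add_one ((2 * S / ε + 1) ^ d)]
  obtain hN : (Metric.maximalSeparatedSet ε.toNNReal Θ).Finite := by
    rw [← Set.encard_ne_top_iff, Metric.encard_maximalSeparatedSet hfin]
    exact hfin
  refine ⟨hN.toFinset, fun c hc => Metric.maximalSeparatedSet_subset (hN.mem_toFinset.1 hc), ?_, ?_⟩
  · intro θ hθ
    obtain ⟨c, hc, hθc⟩ := Metric.isCover_maximalSeparatedSet hfin hθ
    refine ⟨c, hN.mem_toFinset.2 hc, ?_⟩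
    have hθc' : edist θ c ≤ ENNReal.ofReal ε := hθc
    rw [edist_dist] at hθc'
    exact (ENNReal.ofReal_le_ofReal_iff hε.le).1 hθc'
  · exact card_le_of_isSeparated hS hε _
      (fun c hc => hΘ c (Metric.maximalSeparatedSet_subset (hN.mem_toFinset.1 hc)))
      (fun c hc c' hc' => hsep _ Metric.isSeparated_maximalSeparatedSet c (hN.mem_toFinset.1 hc) c'
        (hN.mem_toFinset.1 hc'))


/-! ### Conditional expectations of indicators -/

/-- The real-valued indicator function of a set. -/
abbrev ind {Ω : Type*} (s : Set Ω) : Ω → ℝ := s.indicator fun _ => (1 : ℝ)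

section

variable {Ω : Type*}

theorem ind_nonneg (s : Set Ω) (ω : Ω) : 0 ≤ ind s ω :=
  Set.indicator_nonneg (fun _ _ => zero_le_one) ω

theorem ind_le_one (s : Set Ω) (ω : Ω) : ind s ω ≤ 1 :=
  Set.indicator_le_self' (f := fun _ => (1 : ℝ)) (fun _ _ => zero_le_one) ω

theorem norm_ind_le_one (s : Set Ω) (ω : Ω) : ‖ind s ω‖ ≤ 1 := by
  rw [Real.norm_eq_abs, abs_of_nonneg (ind_nonneg s ω)]
  exact ind_le_one s ω

variable [mΩ : MeasurableSpace Ω] {P : Measure Ω} [IsProbabilityMeasure P]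

theorem measurable_ind {s : Set Ω} (hs : MeasurableSet s) : Measurable (ind s) :=
  measurable_const.indicator hs

theorem integrable_ind {s : Set Ω} (hs : MeasurableSet s) : Integrable (ind s) P :=
  (integrable_const _).indicator hs

theorem integrable_of_abs_le {g : Ω → ℝ} (hg : Measurable g) {C : ℝ} (h : ∀ ω, |g ω| ≤ C) :
    Integrable g P :=
  Integrable.of_bound hg.aestronglyMeasurable C (Filter.Eventually.of_forall h)

theorem integral_mul_condExp {m : MeasurableSpace Ω} (hm : m ≤ mΩ) {W g : Ω → ℝ}
    (hW : Measurable[m] W) (hWg : Integrable (fun ω => W ω * g ω) P) (hg : Integrable g P) :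
    ∫ ω, W ω * (P[g | m]) ω ∂P = ∫ ω, W ω * g ω ∂P := by
  rw [← integral_condExp hm (f := fun ω => W ω * g ω)]
  exact integral_congr_ae (condExp_mul_of_stronglyMeasurable_left hW.stronglyMeasurable hWg hg).symm

/-! ### The posterior sample has the law of the parameter, given history and context -/

/-- If the context `X` is chosen without access to `θs` given the history `H`, and `θt` is drawn
from the posterior of `θs` given `H`, then `(H, X, θs)` and `(H, X, θt)` have the same law. -/
theorem map_param_eq_map_sample {η 𝒳 E : Type*} [MeasurableSpace η] [MeasurableSpace 𝒳]
    [MeasurableSpace E] [StandardBorelSpace E] [Nonempty E]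
    {H : Ω → η} {X : Ω → 𝒳} {θs θt : Ω → E} (hH : Measurable H) (hX : Measurable X)
    (hθs : Measurable θs) (hθt : Measurable θt) (hctx : CondIndepGiven P X θs H)
    (hsample : ∀ B : Set E, MeasurableSet B →
      P⟦θt ⁻¹' B | sigmaGen (fun ω => (H ω, X ω))⟧
        =ᵐ[P] fun ω => (condDistrib θs H P (H ω)).real B) :
    P.map (fun ω => ((H ω, X ω), θs ω)) = P.map (fun ω => ((H ω, X ω), θt ω)) := by
  have : IsProbabilityMeasure (P.map (fun ω => ((H ω, X ω), θs ω))) :=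
    Measure.isProbabilityMeasure_map (by fun_prop)
  refine Measure.ext_prod₃' fun {F D B} hF hD hB => ?_
  have hmF := hH hF
  have hmD := hX hD
  -- both sides are integrals of products of three indicators
  have hprod : ∀ θ : Ω → E, Measurable θ →
      (P.map (fun ω => ((H ω, X ω), θ ω))) ((F ×ˢ D) ×ˢ B) = ENNReal.ofReal
        (∫ ω, (ind (H ⁻¹' F) ω * ind (X ⁻¹' D) ω) * ind (θ ⁻¹' B) ω ∂P) := by
    intro θ hθ
    rw [Measure.map_apply (by fun_prop) ((hF.prod hD).prod hB)]
    have : (fun ω => (ind (H ⁻¹' F) ω * ind (X ⁻¹' D) ω) * ind (θ ⁻¹' B) ω)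
        = ((H ⁻¹' F ∩ X ⁻¹' D) ∩ θ ⁻¹' B).indicator 1 := by
      ext ω
      by_cases h1 : H ω ∈ F <;> by_cases h2 : X ω ∈ D <;> by_cases h3 : θ ω ∈ B <;>
        simp [ind, Set.indicator, h1, h2, h3]
    rw [this, integral_indicator_one ((hmF.inter hmD).inter (hθ hB)), ofReal_measureReal]
    rfl
  rw [hprod θs hθs, hprod θt hθt]
  congr 1
  have hmB := hθs hB
  have hmBt := hθt hB
  -- products with indicators are integrable
  have hbdd : ∀ {s : Set Ω} {g : Ω → ℝ}, MeasurableSet s → Integrable g P →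
      Integrable (fun ω => ind s ω * g ω) P := fun hs hg =>
    hg.bdd_mul (measurable_ind hs).aestronglyMeasurable
      (Filter.Eventually.of_forall (norm_ind_le_one _))
  have hsH : sigmaGen H ≤ mΩ := hH.comap_le
  have hsHθ : sigmaGen (fun ω => (H ω, θs ω)) ≤ mΩ := (hH.prodMk hθs).comap_le
  have hsHX : sigmaGen (fun ω => (H ω, X ω)) ≤ mΩ := (hH.prodMk hX).comap_le
  have hFH : Measurable[sigmaGen H] (ind (H ⁻¹' F)) :=
    @measurable_ind _ (sigmaGen H) _ ⟨F, hF, rfl⟩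
  have hD_condExp : Measurable[sigmaGen H] (P⟦X ⁻¹' D | sigmaGen H⟧) :=
    stronglyMeasurable_condExp.measurable
  have hB_condExp : Measurable[sigmaGen H] (P⟦θs ⁻¹' B | sigmaGen H⟧) :=
    stronglyMeasurable_condExp.measurable
  have hiD : Integrable (ind (X ⁻¹' D)) P := integrable_ind hmD
  have hiB : Integrable (ind (θs ⁻¹' B)) P := integrable_ind hmB
  have hiBt : Integrable (ind (θt ⁻¹' B)) P := integrable_ind hmBt
  have hiDH : Integrable (P⟦X ⁻¹' D | sigmaGen H⟧) P := integrable_condExp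
  have hiBH : Integrable (P⟦θs ⁻¹' B | sigmaGen H⟧) P := integrable_condExp
  calc ∫ ω, (ind (H ⁻¹' F) ω * ind (X ⁻¹' D) ω) * ind (θs ⁻¹' B) ω ∂P
      = ∫ ω, (ind (H ⁻¹' F) ω * ind (θs ⁻¹' B) ω) * ind (X ⁻¹' D) ω ∂P := by
        congr 1 with ω; ring
    _ = ∫ ω, (ind (H ⁻¹' F) ω * ind (θs ⁻¹' B) ω)
          * (P⟦X ⁻¹' D | sigmaGen (fun ω => (H ω, θs ω))⟧) ω ∂P := by
        refine (integral_mul_condExp hsHθ ?_ ?_ hiD).symm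
        · refine Measurable.mul ?_ ?_
          · exact @measurable_ind _ (sigmaGen fun ω => (H ω, θs ω)) _
              ⟨F ×ˢ Set.univ, hF.prod .univ, by ext; simp⟩
          · exact @measurable_ind _ (sigmaGen fun ω => (H ω, θs ω)) _
              ⟨Set.univ ×ˢ B, MeasurableSet.univ.prod hB, by ext; simp⟩
        · simpa only [mul_assoc] using hbdd hmF (hbdd hmB hiD)
    _ = ∫ ω, (ind (H ⁻¹' F) ω * (P⟦X ⁻¹' D | sigmaGen H⟧) ω) * ind (θs ⁻¹' B) ω ∂P := by
        refine integral_congr_ae ?_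
        filter_upwards [hctx D hD] with ω hω
        rw [hω]; ring
    _ = ∫ ω, (ind (H ⁻¹' F) ω * (P⟦X ⁻¹' D | sigmaGen H⟧) ω)
          * (P⟦θs ⁻¹' B | sigmaGen H⟧) ω ∂P := by
        refine (integral_mul_condExp hsH (hFH.mul hD_condExp) ?_ hiB).symm
        refine (hbdd hmF (hbdd hmB hiDH)).congr (Filter.Eventually.of_forall fun ω => ?_)
        simp only [Pi.mul_apply]
        ring
    _ = ∫ ω, (ind (H ⁻¹' F) ω * (P⟦θs ⁻¹' B | sigmaGen H⟧) ω)
          * (P⟦X ⁻¹' D | sigmaGen H⟧) ω ∂P := by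
        congr 1 with ω; ring
    _ = ∫ ω, (ind (H ⁻¹' F) ω * (P⟦θs ⁻¹' B | sigmaGen H⟧) ω) * ind (X ⁻¹' D) ω ∂P := by
        refine integral_mul_condExp hsH (hFH.mul hB_condExp) ?_ hiD
        refine (hbdd hmF (hbdd hmD hiBH)).congr (Filter.Eventually.of_forall fun ω => ?_)
        ring
    _ = ∫ ω, (ind (H ⁻¹' F) ω * ind (X ⁻¹' D) ω)
          * (P⟦θt ⁻¹' B | sigmaGen (fun ω => (H ω, X ω))⟧) ω ∂P := by
        refine integral_congr_ae ?_
        filter_upwards [hsample B hB, condDistrib_ae_eq_condExp hH hθs hB (μ := P)] with ω h1 h2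
        rw [h1, h2]; ring
    _ = ∫ ω, (ind (H ⁻¹' F) ω * ind (X ⁻¹' D) ω) * ind (θt ⁻¹' B) ω ∂P := by
        refine integral_mul_condExp hsHX ?_ ?_ hiBt
        · refine Measurable.mul ?_ ?_
          · exact @measurable_ind _ (sigmaGen fun ω => (H ω, X ω)) _
              ⟨F ×ˢ Set.univ, hF.prod .univ, by ext; simp⟩
          · exact @measurable_ind _ (sigmaGen fun ω => (H ω, X ω)) _
              ⟨Set.univ ×ˢ D, MeasurableSet.univ.prod hD, by ext; simp⟩
        · simpa only [mul_assoc] using hbdd hmF (hbdd hmD hiBt)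

/-! ### Decoupling the action from the posterior sample -/

/-- Let `θs` and `θt` have the same law jointly with `Z`, and let the event `s` be independent of
`θs`, but not necessarily of `θt`, given `Z`. The mean of `|D (Z, θt)|` on `s` is controlled by the
mean of `D (Z, θs) ^ 2` on `s`: with `π = P(s | Z)` this is the AM-GM inequality for
`|D| ≤ 1 / (2 c π) + c π D ^ 2 / 2`, in which `1 / π` has mean at most one on `s`. -/
theorem integral_ind_mul_abs_le {γ E : Type*} [MeasurableSpace γ] [MeasurableSpace E]
    {Z : Ω → γ} {θs θt : Ω → E} (hZ : Measurable Z) (hθs : Measurable θs) (hθt : Measurable θt)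
    (hmap : P.map (fun ω => (Z ω, θs ω)) = P.map (fun ω => (Z ω, θt ω)))
    {s : Set Ω} (hs : MeasurableSet s)
    (hci : P⟦s | sigmaGen (fun ω => (Z ω, θs ω))⟧ =ᵐ[P] P⟦s | sigmaGen Z⟧)
    {D : γ × E → ℝ} (hD : Measurable D) (hD1 : ∀ p, |D p| ≤ 1) {c : ℝ} (hc : 0 < c) :
    ∫ ω, ind s ω * |D (Z ω, θt ω)| ∂P
      ≤ 1 / (2 * c) + c / 2 * ∫ ω, ind s ω * D (Z ω, θs ω) ^ 2 ∂P := by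
  obtain ⟨h, hh, hhZ⟩ := Measurable.exists_eq_measurable_comp
    (stronglyMeasurable_condExp.measurable : Measurable[sigmaGen Z] (P⟦s | sigmaGen Z⟧))
  -- a version of the conditional probability with values in `[0, 1]`
  let π : γ → ℝ := fun z => max 0 (min 1 (h z))
  have hπ : Measurable π := measurable_const.max (measurable_const.min hh)
  have hπ0 : ∀ z, 0 ≤ π z := fun z => le_max_left _ _
  have hπ1 : ∀ z, π z ≤ 1 := fun z => max_le zero_le_one (min_le_left _ _)
  have hs0 : Integrable (ind s) P := integrable_ind hs
  have hπs : P⟦s | sigmaGen Z⟧ =ᵐ[P] fun ω => π (Z ω) := by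
    have h0 : 0 ≤ᵐ[P] P⟦s | sigmaGen Z⟧ :=
      condExp_nonneg (Filter.Eventually.of_forall (ind_nonneg s))
    have h1 := ae_bdd_abs_condExp_of_ae_bdd_abs (m := sigmaGen Z) (μ := P) (R := (1 : ℝ))
      (f := ind s) (Filter.Eventually.of_forall (norm_ind_le_one s))
    filter_upwards [h0, h1] with ω hω0 hω1
    rw [hhZ] at hω0 hω1 ⊢
    have hω1' := (le_abs_self _).trans hω1
    simp only [Function.comp_apply, Pi.zero_apply] at hω0 hω1' ⊢
    simp only [π, min_eq_right hω1', max_eq_right hω0]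
  have hZsZ : Measurable (fun ω => (Z ω, θs ω)) := hZ.prodMk hθs
  have hZtZ : Measurable (fun ω => (Z ω, θt ω)) := hZ.prodMk hθt
  have hDsq : ∀ p, D p ^ 2 ≤ 1 := fun p => (sq_le_one_iff_abs_le_one _).2 (hD1 p)
  -- conditioning on `Z`, and on `Z` and `θs`
  have hcondZ : ∀ V : γ → ℝ, Measurable V → (∃ C, ∀ z, |V z| ≤ C) →
      ∫ ω, V (Z ω) * ind s ω ∂P = ∫ ω, V (Z ω) * π (Z ω) ∂P := by
    rintro V hV ⟨C, hC⟩
    refine (integral_mul_condExp (W := fun ω => V (Z ω)) hZ.comap_le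
      (hV.comp (comap_measurable Z)) (hs0.bdd_mul (hV.comp hZ).aestronglyMeasurable
        (Filter.Eventually.of_forall fun ω => hC _)) hs0).symm.trans (integral_congr_ae ?_)
    filter_upwards [hπs] with ω hω
    exact congrArg _ hω
  have hcondZθ : ∫ ω, D (Z ω, θs ω) ^ 2 * ind s ω ∂P
      = ∫ ω, D (Z ω, θs ω) ^ 2 * π (Z ω) ∂P := by
    refine (integral_mul_condExp (W := fun ω => D (Z ω, θs ω) ^ 2) hZsZ.comap_le
      ((hD.pow_const 2).comp (comap_measurable fun ω => (Z ω, θs ω)))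
      (hs0.bdd_mul ((hD.pow_const 2).comp hZsZ).aestronglyMeasurable
        (c := 1) (Filter.Eventually.of_forall fun ω => ?_)) hs0).symm.trans (integral_congr_ae ?_)
    rotate_left
    · filter_upwards [hπs, hci] with ω hω hω'
      exact congrArg _ (hω'.trans hω)
    · rw [Real.norm_eq_abs, abs_of_nonneg (sq_nonneg _)]
      exact hDsq _
  -- `1 / π` is regularized to `1 / (π + δ)`, at a cost of `c δ / 2 = ε`
  refine le_of_forall_pos_le_add fun ε hε => ?_
  let δ : ℝ := 2 * ε / c
  have hδ : 0 < δ := by positivity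
  have hπδ : ∀ z, 0 < π z + δ := fun z => add_pos_of_nonneg_of_pos (hπ0 z) hδ
  let V : γ → ℝ := fun z => 1 / (2 * c * (π z + δ))
  have hV : Measurable V := measurable_const.div (measurable_const.mul (hπ.add_const δ))
  have hVb : ∀ z, |V z| ≤ 1 / (2 * c * δ) := by
    intro z
    have := hπδ z
    have := hπ0 z
    rw [abs_of_pos (by positivity)]
    exact one_div_le_one_div_of_le (by positivity) (by nlinarith)
  have hVπ : ∀ z, V z * π z ≤ 1 / (2 * c) := by
    intro z
    have := hπδ z
    simp only [V]
    rw [div_mul_eq_mul_div, one_mul, div_le_div_iff₀ (by positivity) (by positivity)]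
    nlinarith
  let U : γ × E → ℝ := fun p => (π p.1 + δ) * D p ^ 2
  have hU : Measurable U := ((hπ.comp measurable_fst).add_const δ).mul (hD.pow_const 2)
  have hUb : ∀ p, |U p| ≤ 1 + δ := by
    intro p
    have := hπδ p.1
    rw [abs_of_nonneg (by positivity)]
    have h1 := hπ1 p.1
    calc U p ≤ (π p.1 + δ) * 1 := mul_le_mul_of_nonneg_left (hDsq p) this.le
      _ ≤ 1 + δ := by linarith
  have hUint : Integrable (fun ω => U (Z ω, θt ω)) P :=
    integrable_of_abs_le (hU.comp hZtZ) fun ω => hUb _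
  have hVint : Integrable (fun ω => V (Z ω) * ind s ω) P :=
    hs0.bdd_mul (hV.comp hZ).aestronglyMeasurable (Filter.Eventually.of_forall fun ω => hVb _)
  have hUmap : ∫ ω, U (Z ω, θt ω) ∂P = ∫ ω, U (Z ω, θs ω) ∂P := by
    rw [← integral_map (φ := fun ω => (Z ω, θt ω)) hZtZ.aemeasurable hU.aestronglyMeasurable,
      ← hmap, integral_map hZsZ.aemeasurable hU.aestronglyMeasurable]
  have hDπint : Integrable (fun ω => D (Z ω, θs ω) ^ 2 * π (Z ω)) P := by
    refine integrable_of_abs_le (C := 1)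
      (((hD.pow_const 2).comp hZsZ).mul (hπ.comp hZ)) fun ω => ?_
    rw [abs_of_nonneg (mul_nonneg (sq_nonneg _) (hπ0 _))]
    exact mul_le_one₀ (hDsq _) (hπ0 _) (hπ1 _)
  calc ∫ ω, ind s ω * |D (Z ω, θt ω)| ∂P
      ≤ ∫ ω, (V (Z ω) * ind s ω + c / 2 * U (Z ω, θt ω)) ∂P := by
        refine integral_mono_of_nonneg (Filter.Eventually.of_forall fun ω =>
          mul_nonneg (ind_nonneg s ω) (abs_nonneg _)) (hVint.add (hUint.const_mul _))
          (Filter.Eventually.of_forall fun ω => ?_)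
        have hp := hπδ (Z ω)
        have hamgm := abs_le_inv_add_mul_sq (mul_pos hc hp) (D (Z ω, θt ω))
        have hVU : 1 / (2 * (c * (π (Z ω) + δ)))
            + c * (π (Z ω) + δ) / 2 * D (Z ω, θt ω) ^ 2
            = V (Z ω) + c / 2 * U (Z ω, θt ω) := by
          simp only [V, U]; ring
        rw [hVU] at hamgm
        have hUn : 0 ≤ c / 2 * U (Z ω, θt ω) := by simp only [U]; positivity
        change ind s ω * |D (Z ω, θt ω)| ≤ V (Z ω) * ind s ω + c / 2 * U (Z ω, θt ω)
        calc ind s ω * |D (Z ω, θt ω)| ≤ ind s ω * (V (Z ω) + c / 2 * U (Z ω, θt ω)) :=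
              mul_le_mul_of_nonneg_left hamgm (ind_nonneg s ω)
          _ ≤ _ := by nlinarith [ind_le_one s ω]
    _ = ∫ ω, V (Z ω) * π (Z ω) ∂P + c / 2 * ∫ ω, U (Z ω, θs ω) ∂P := by
        rw [integral_add hVint (hUint.const_mul _), integral_const_mul, hUmap,
          hcondZ V hV ⟨_, hVb⟩]
    _ ≤ 1 / (2 * c) + c / 2 * (∫ ω, D (Z ω, θs ω) ^ 2 * π (Z ω) ∂P + δ) := by
        refine add_le_add ?_ (mul_le_mul_of_nonneg_left ?_ (by positivity))
        · calc ∫ ω, V (Z ω) * π (Z ω) ∂P ≤ ∫ _, 1 / (2 * c) ∂P := by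
                refine integral_mono_of_nonneg (Filter.Eventually.of_forall fun ω => ?_)
                  (integrable_const _) (Filter.Eventually.of_forall fun ω => hVπ _)
                have := hπδ (Z ω)
                have := hπ0 (Z ω)
                simp only [V, Pi.zero_apply]
                positivity
            _ = 1 / (2 * c) := by simp
        · calc ∫ ω, U (Z ω, θs ω) ∂P
              ≤ ∫ ω, (D (Z ω, θs ω) ^ 2 * π (Z ω) + δ) ∂P := by
                refine integral_mono (integrable_of_abs_le (hU.comp hZsZ) fun ω => hUb _)
                  (hDπint.add (integrable_const _)) fun ω => ?_
                have := hDsq (Z ω, θs ω)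
                simp only [U]
                nlinarith
            _ = ∫ ω, D (Z ω, θs ω) ^ 2 * π (Z ω) ∂P + δ := by
                rw [integral_add hDπint (integrable_const _)]; simp
    _ = 1 / (2 * c) + c / 2 * ∫ ω, ind s ω * D (Z ω, θs ω) ^ 2 ∂P + ε := by
        rw [← hcondZθ]
        have : c / 2 * δ = ε := by simp only [δ]; field_simp
        rw [mul_add, this, add_assoc]
        simp only [mul_comm (ind s _)]

end


/-! ### The regret of one round -/

theorem sum_ind_action_mul {Ω : Type*} {K : ℕ} (A : Ω → Fin K) (u : Fin K → ℝ) (ω : Ω) :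
    ∑ a, ind (A ⁻¹' {a}) ω * u a = u (A ω) := by
  rw [Finset.sum_eq_single (A ω)]
  · simp [ind]
  · intro b _ hb
    simp [ind, Set.indicator, hb.symm]
  · simp

section

variable {Ω : Type*} [mΩ : MeasurableSpace Ω] {P : Measure Ω} [IsProbabilityMeasure P]

theorem measurable_comp_action {α : Type*} [MeasurableSpace α] {K : ℕ} {F : α → Fin K → ℝ}
    (hF : ∀ a, Measurable fun p => F p a) {Y : Ω → α} {A : Ω → Fin K} (hY : Measurable Y)
    (hA : Measurable A) : Measurable fun ω => F (Y ω) (A ω) :=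
  (measurable_from_prod_countable_left (f := fun p : α × Fin K => F p.1 p.2) hF).comp
    (hY.prodMk hA)

theorem eq_iInf_of_forall_le {K : ℕ} {u : Fin K → ℝ} {a : Fin K} (h : ∀ b, u a ≤ u b) :
    u a = ⨅ b, u b :=
  have : Nonempty (Fin K) := ⟨a⟩
  le_antisymm (le_ciInf h) (ciInf_le (Set.finite_range u).bddBelow a)

variable {γ E : Type*} [MeasurableSpace γ] [MeasurableSpace E] {K : ℕ}
  {Z : Ω → γ} {θs θt : Ω → E} {A Astar : Ω → Fin K}
  {l : γ × E → Fin K → ℝ}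

theorem integrable_loss_optimal (hZ : Measurable Z) (hθs : Measurable θs)
    (hl : ∀ a, Measurable fun p => l p a) (hl01 : ∀ p a, l p a ∈ Set.Icc (0 : ℝ) 1)
    (hAstar : ∀ᵐ ω ∂P, ∀ b, l (Z ω, θs ω) (Astar ω) ≤ l (Z ω, θs ω) b) :
    Integrable (fun ω => l (Z ω, θs ω) (Astar ω)) P := by
  have hm : Measurable fun p => ⨅ b, l p b := Measurable.iInf hl
  refine Integrable.of_bound (C := 1) ⟨fun ω => ⨅ b, l (Z ω, θs ω) b,
    (hm.comp (hZ.prodMk hθs)).stronglyMeasurable, ?_⟩ (Filter.Eventually.of_forall fun ω => ?_)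
  · filter_upwards [hAstar] with ω hω using eq_iInf_of_forall_le hω
  · rw [Real.norm_eq_abs, abs_of_nonneg (hl01 _ _).1]
    exact (hl01 _ _).2

theorem integrable_loss_action (hZ : Measurable Z) (hθs : Measurable θs) (hA : Measurable A)
    (hl : ∀ a, Measurable fun p => l p a) (hl01 : ∀ p a, l p a ∈ Set.Icc (0 : ℝ) 1) :
    Integrable (fun ω => l (Z ω, θs ω) (A ω)) P := by
  refine integrable_of_abs_le (C := 1) (measurable_comp_action hl (hZ.prodMk hθs) hA) fun ω => ?_
  rw [abs_of_nonneg (hl01 _ _).1]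
  exact (hl01 _ _).2

/-- One round of Thompson sampling: `Z` stands for the history and the context, `l` for the mean
loss, and `g Z a` for any prediction of the mean loss of `a`. The regret is controlled by the
squared error of the prediction of the mean loss of the action played. As `θs` and `θt` have the
same law given `Z`, the optimal mean losses under the two have the same mean; so the regret is the
mean of `l (Z, θs) A - l (Z, θt) A`. Both terms are compared to the prediction, which must not
depend on the parameter. -/
theorem round_regret_le (hZ : Measurable Z) (hθs : Measurable θs) (hθt : Measurable θt)
    (hA : Measurable A)
    (hmap : P.map (fun ω => (Z ω, θs ω)) = P.map (fun ω => (Z ω, θt ω)))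
    (hci : ∀ a, P⟦A ⁻¹' {a} | sigmaGen (fun ω => (Z ω, θs ω))⟧
      =ᵐ[P] P⟦A ⁻¹' {a} | sigmaGen Z⟧)
    (hl : ∀ a, Measurable fun p => l p a) (hl01 : ∀ p a, l p a ∈ Set.Icc (0 : ℝ) 1)
    {g : γ → Fin K → ℝ} (hg : ∀ a, Measurable fun z => g z a)
    (hg01 : ∀ z a, g z a ∈ Set.Icc (0 : ℝ) 1)
    (hAt : ∀ᵐ ω ∂P, ∀ b, l (Z ω, θt ω) (A ω) ≤ l (Z ω, θt ω) b)
    (hAstar : ∀ᵐ ω ∂P, ∀ b, l (Z ω, θs ω) (Astar ω) ≤ l (Z ω, θs ω) b)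
    {c : ℝ} (hc : 0 < c) :
    ∫ ω, (l (Z ω, θs ω) (A ω) - l (Z ω, θs ω) (Astar ω)) ∂P
      ≤ (K + 1) / (2 * c) + c * ∫ ω, (l (Z ω, θs ω) (A ω) - g (Z ω) (A ω)) ^ 2 ∂P := by
  let D : γ × E → Fin K → ℝ := fun p a => l p a - g p.1 a
  have hD : ∀ a, Measurable fun p => D p a := fun a => (hl a).sub ((hg a).comp measurable_fst)
  have hD1 : ∀ p a, |D p a| ≤ 1 := fun p a =>
    abs_sub_le_iff.2 ⟨by linarith [(hl01 p a).2, (hg01 p.1 a).1],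
      by linarith [(hl01 p a).1, (hg01 p.1 a).2]⟩
  have hDsq : ∀ p a, D p a ^ 2 ≤ 1 := fun p a => (sq_le_one_iff_abs_le_one _).2 (hD1 p a)
  have hZs : Measurable fun ω => (Z ω, θs ω) := hZ.prodMk hθs
  have hZt : Measurable fun ω => (Z ω, θt ω) := hZ.prodMk hθt
  have hDs : Measurable fun ω => D (Z ω, θs ω) (A ω) := measurable_comp_action hD hZs hA
  have hDt : Measurable fun ω => D (Z ω, θt ω) (A ω) := measurable_comp_action hD hZt hA
  have hDsI : Integrable (fun ω => D (Z ω, θs ω) (A ω)) P :=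
    integrable_of_abs_le hDs fun ω => hD1 _ _
  have hDtI : Integrable (fun ω => D (Z ω, θt ω) (A ω)) P :=
    integrable_of_abs_le hDt fun ω => hD1 _ _
  have hDs2I : Integrable (fun ω => D (Z ω, θs ω) (A ω) ^ 2) P :=
    integrable_of_abs_le (C := 1) (hDs.pow_const 2) fun ω => by
      rw [abs_of_nonneg (sq_nonneg _)]
      exact hDsq _ _
  -- the optimal mean losses under `θs` and under `θt` have the same mean
  have hopt : ∫ ω, l (Z ω, θs ω) (Astar ω) ∂P = ∫ ω, l (Z ω, θt ω) (A ω) ∂P := by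
    have hm : Measurable fun p => ⨅ b, l p b := Measurable.iInf hl
    calc ∫ ω, l (Z ω, θs ω) (Astar ω) ∂P = ∫ ω, ⨅ b, l (Z ω, θs ω) b ∂P :=
          integral_congr_ae (by
            filter_upwards [hAstar] with ω hω using eq_iInf_of_forall_le hω)
      _ = ∫ ω, ⨅ b, l (Z ω, θt ω) b ∂P := by
          rw [← integral_map (φ := fun ω => (Z ω, θs ω)) (f := fun p => ⨅ b, l p b)
            hZs.aemeasurable hm.aestronglyMeasurable, hmap,
            integral_map hZt.aemeasurable hm.aestronglyMeasurable]
      _ = ∫ ω, l (Z ω, θt ω) (A ω) ∂P :=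
          integral_congr_ae (by
            filter_upwards [hAt] with ω hω using (eq_iInf_of_forall_le hω).symm)
  have hsplit : ∫ ω, (l (Z ω, θs ω) (A ω) - l (Z ω, θs ω) (Astar ω)) ∂P
      = ∫ ω, D (Z ω, θs ω) (A ω) ∂P - ∫ ω, D (Z ω, θt ω) (A ω) ∂P := by
    rw [integral_sub (integrable_loss_action hZ hθs hA hl hl01)
      (integrable_loss_optimal hZ hθs hl hl01 hAstar), hopt,
      ← integral_sub (integrable_loss_action hZ hθs hA hl hl01)
      (integrable_loss_action hZ hθt hA hl hl01), ← integral_sub hDsI hDtI]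
    congr 1 with ω
    simp only [D]
    ring
  have h1 : ∫ ω, D (Z ω, θs ω) (A ω) ∂P
      ≤ 1 / (2 * c) + c / 2 * ∫ ω, D (Z ω, θs ω) (A ω) ^ 2 ∂P := by
    calc ∫ ω, D (Z ω, θs ω) (A ω) ∂P
        ≤ ∫ ω, (1 / (2 * c) + c / 2 * D (Z ω, θs ω) (A ω) ^ 2) ∂P :=
          integral_mono hDsI ((integrable_const _).add (hDs2I.const_mul _)) fun ω =>
            (le_abs_self _).trans (abs_le_inv_add_mul_sq hc _)
      _ = _ := by
          rw [integral_add (integrable_const _) (hDs2I.const_mul _), integral_const_mul]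
          simp
  have h2 : -∫ ω, D (Z ω, θt ω) (A ω) ∂P
      ≤ K / (2 * c) + c / 2 * ∫ ω, D (Z ω, θs ω) (A ω) ^ 2 ∂P := by
    have hint : ∀ a, Integrable (fun ω => ind (A ⁻¹' {a}) ω * |D (Z ω, θt ω) a|) P := fun a =>
      (integrable_of_abs_le ((hD a).comp hZt).norm fun ω => by
        simpa using hD1 (Z ω, θt ω) a).bdd_mul
        (measurable_ind (hA (measurableSet_singleton a))).aestronglyMeasurable
        (Filter.Eventually.of_forall (norm_ind_le_one _))
    have hint2 : ∀ a, Integrable (fun ω => ind (A ⁻¹' {a}) ω * D (Z ω, θs ω) a ^ 2) P := fun a =>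
      (integrable_of_abs_le (C := 1) (((hD a).comp hZs).pow_const 2) fun ω => by
        simpa using hD1 (Z ω, θs ω) a).bdd_mul
        (measurable_ind (hA (measurableSet_singleton a))).aestronglyMeasurable
        (Filter.Eventually.of_forall (norm_ind_le_one _))
    calc -∫ ω, D (Z ω, θt ω) (A ω) ∂P ≤ ∫ ω, |D (Z ω, θt ω) (A ω)| ∂P := by
          rw [← integral_neg]
          exact integral_mono hDtI.neg hDtI.abs fun ω => neg_le_abs _
      _ = ∑ a, ∫ ω, ind (A ⁻¹' {a}) ω * |D (Z ω, θt ω) a| ∂P := by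
          rw [← integral_finsetSum _ fun a _ => hint a]
          congr 1 with ω
          exact (sum_ind_action_mul A (fun a => |D (Z ω, θt ω) a|) ω).symm
      _ ≤ ∑ a, (1 / (2 * c) + c / 2 * ∫ ω, ind (A ⁻¹' {a}) ω * D (Z ω, θs ω) a ^ 2 ∂P) :=
          Finset.sum_le_sum fun a _ => integral_ind_mul_abs_le hZ hθs hθt hmap
            (hA (measurableSet_singleton a)) (hci a) (hD a) (fun p => hD1 p a) hc
      _ = _ := by
          rw [Finset.sum_add_distrib, ← Finset.mul_sum, ← integral_finsetSum _ fun a _ => hint2 a,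
            Finset.sum_const, Finset.card_univ, Fintype.card_fin, nsmul_eq_mul, mul_one_div]
          congr 3 with ω
          exact sum_ind_action_mul A (fun a => D (Z ω, θs ω) a ^ 2) ω
  rw [hsplit]
  have : ((K : ℝ) + 1) / (2 * c) = K / (2 * c) + 1 / (2 * c) := by ring
  rw [this]
  change _ ≤ _ + c * ∫ ω, D (Z ω, θs ω) (A ω) ^ 2 ∂P
  linarith

/-! ### The prediction error is paid for by the log-loss -/

/-- If `L` is Bernoulli with parameter `p` given `m`, the excess log-loss of an `m`-measurable
prediction `q` has a mean of at least twice the squared error, by Pinsker's inequality. -/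
theorem two_mul_integral_sq_le_integral_log {L : Ω → Bool} (hL : Measurable L)
    {m : MeasurableSpace Ω} (hm : m ≤ mΩ) {p q : Ω → ℝ} (hp : Measurable[m] p) (hq : Measurable[m] q)
    (hp01 : ∀ ω, p ω ∈ Set.Ioo (0 : ℝ) 1) (hq01 : ∀ ω, q ω ∈ Set.Ioo (0 : ℝ) 1)
    (hlaw : P⟦L ⁻¹' {true} | m⟧ =ᵐ[P] p) {C : ℝ}
    (h1 : ∀ᵐ ω ∂P, |Real.log (p ω) - Real.log (q ω)| ≤ C)
    (h0 : ∀ᵐ ω ∂P, |Real.log (1 - p ω) - Real.log (1 - q ω)| ≤ C)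
    {G : Ω → ℝ} (hG : ∀ ω, G ω = if L ω then Real.log (p ω) - Real.log (q ω)
      else Real.log (1 - p ω) - Real.log (1 - q ω)) :
    Integrable G P ∧ 2 * ∫ ω, (p ω - q ω) ^ 2 ∂P ≤ ∫ ω, G ω ∂P := by
  let W1 : Ω → ℝ := fun ω => Real.log (p ω) - Real.log (q ω)
  let W0 : Ω → ℝ := fun ω => Real.log (1 - p ω) - Real.log (1 - q ω)
  have hW1 : Measurable[m] W1 := hp.log.sub hq.log
  have hW0 : Measurable[m] W0 := (hp.const_sub 1).log.sub (hq.const_sub 1).log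
  have hW1I : Integrable W1 P := Integrable.of_bound (hW1.mono hm le_rfl).aestronglyMeasurable C h1
  have hW0I : Integrable W0 P := Integrable.of_bound (hW0.mono hm le_rfl).aestronglyMeasurable C h0
  have hdiff : Measurable[m] (fun ω => W1 ω - W0 ω) := hW1.sub hW0
  have hs : MeasurableSet[mΩ] (L ⁻¹' {true}) := hL (measurableSet_singleton _)
  have hG' : G = fun ω => (W1 ω - W0 ω) * ind (L ⁻¹' {true}) ω + W0 ω := by
    ext ω
    by_cases h : L ω = true <;> simp [hG, W1, W0, ind, Set.indicator, h]
  have hI : Integrable (fun ω => (W1 ω - W0 ω) * ind (L ⁻¹' {true}) ω) P :=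
    (hW1I.sub hW0I).mul_bdd (measurable_ind (mΩ := mΩ) hs).aestronglyMeasurable
      (Filter.Eventually.of_forall (norm_ind_le_one _))
  have hpI : Integrable (fun ω => (W1 ω - W0 ω) * p ω) P := by
    refine (hW1I.sub hW0I).mul_bdd (c := 1) (hp.mono hm le_rfl).aestronglyMeasurable
      (Filter.Eventually.of_forall fun ω => ?_)
    rw [Real.norm_eq_abs, abs_of_pos (hp01 ω).1]
    exact (hp01 ω).2.le
  refine ⟨by rw [hG']; exact hI.add hW0I, ?_⟩
  have hGint : ∫ ω, G ω ∂P = ∫ ω, ((W1 ω - W0 ω) * p ω + W0 ω) ∂P := by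
    rw [hG', integral_add hI hW0I, integral_add hpI hW0I,
      ← integral_mul_condExp (mΩ := mΩ) hm hdiff hI (integrable_ind (mΩ := mΩ) hs)]
    congr 1
    refine integral_congr_ae ?_
    filter_upwards [hlaw] with ω hω
    rw [hω]
  rw [hGint, ← integral_const_mul]
  refine integral_mono_of_nonneg (Filter.Eventually.of_forall fun ω => by positivity)
    (hpI.add hW0I) (Filter.Eventually.of_forall fun ω => ?_)
  have := two_mul_sq_sub_le_bernoulli_kl (hp01 ω).1 (hp01 ω).2 (hq01 ω).1 (hq01 ω).2
  simp only [W1, W0]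
  linarith

end


/-! ### Likelihoods and the mixture over a net -/

/-- The likelihood of the loss `y` of action `a` in context `x` under parameter `θ`, the loss `1`
being `true`. Since `1 - σ z = σ (-z)`, both cases are values of the sigmoid. -/
def lossLik {𝒳 : Type*} {d K : ℕ} (f : EuclideanSpace ℝ (Fin d) → 𝒳 → Fin K → ℝ)
    (θ : EuclideanSpace ℝ (Fin d)) (x : 𝒳) (a : Fin K) (y : Bool) : ℝ :=
  Real.sigmoid (if y then f θ x a else -f θ x a)

/-- The likelihood under `θ` of the losses in the history `h`, given its contexts and actions. -/
def seqLik {𝒳 : Type*} {d K : ℕ} (f : EuclideanSpace ℝ (Fin d) → 𝒳 → Fin K → ℝ)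
    (θ : EuclideanSpace ℝ (Fin d)) {t : ℕ} (h : Fin t → 𝒳 × Fin K × Bool) : ℝ :=
  ∏ s, lossLik f θ (h s).1 (h s).2.1 (h s).2.2

/-- The total likelihood of the history `h` over the parameters in `N`. -/
def netWeight {𝒳 : Type*} {d K : ℕ} (f : EuclideanSpace ℝ (Fin d) → 𝒳 → Fin K → ℝ)
    (N : Finset (EuclideanSpace ℝ (Fin d))) {t : ℕ} (h : Fin t → 𝒳 × Fin K × Bool) : ℝ :=
  ∑ c ∈ N, seqLik f c h

/-- The predictive probability of the loss `y`, after the history `h`, of the Bayesian whose prior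
is uniform on `N`. -/
def netPredict {𝒳 : Type*} {d K : ℕ} (f : EuclideanSpace ℝ (Fin d) → 𝒳 → Fin K → ℝ)
    (N : Finset (EuclideanSpace ℝ (Fin d))) {t : ℕ} (h : Fin t → 𝒳 × Fin K × Bool)
    (x : 𝒳) (a : Fin K) (y : Bool) : ℝ :=
  (∑ c ∈ N, seqLik f c h * lossLik f c x a y) / netWeight f N h

section

variable {𝒳 : Type*} {d K : ℕ} {f : EuclideanSpace ℝ (Fin d) → 𝒳 → Fin K → ℝ}
  {N : Finset (EuclideanSpace ℝ (Fin d))} {t : ℕ}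

theorem meanLoss_mem_Ioo (f : EuclideanSpace ℝ (Fin d) → 𝒳 → Fin K → ℝ)
    (θ : EuclideanSpace ℝ (Fin d)) (x : 𝒳) (a : Fin K) :
    meanLoss f θ x a ∈ Set.Ioo (0 : ℝ) 1 :=
  ⟨Real.sigmoid_pos _, Real.sigmoid_lt_one _⟩

theorem lossLik_pos (θ : EuclideanSpace ℝ (Fin d)) (x : 𝒳) (a : Fin K) (y : Bool) :
    0 < lossLik f θ x a y := Real.sigmoid_pos _

theorem lossLik_true (θ : EuclideanSpace ℝ (Fin d)) (x : 𝒳) (a : Fin K) :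
    lossLik f θ x a true = meanLoss f θ x a := by
  simp [lossLik, meanLoss]

theorem lossLik_false (θ : EuclideanSpace ℝ (Fin d)) (x : 𝒳) (a : Fin K) :
    lossLik f θ x a false = 1 - meanLoss f θ x a := by
  simp [lossLik, meanLoss, Real.sigmoid_neg]

theorem lossLik_le_exp_mul {θ c : EuclideanSpace ℝ (Fin d)} {x : 𝒳} {a : Fin K} {δ : ℝ}
    (h : |f θ x a - f c x a| ≤ δ) (y : Bool) :
    lossLik f θ x a y ≤ Real.exp δ * lossLik f c x a y := by
  refine (sigmoid_le_exp_abs_sub_mul _ (if y then f c x a else -f c x a)).trans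
    (mul_le_mul_of_nonneg_right (Real.exp_le_exp.2 ?_) (lossLik_pos c x a y).le)
  cases y
  · have : -f θ x a - -f c x a = -(f θ x a - f c x a) := by ring
    simpa only [Bool.false_eq_true, if_false, this, abs_neg] using h
  · simpa using h

theorem seqLik_pos (θ : EuclideanSpace ℝ (Fin d)) (h : Fin t → 𝒳 × Fin K × Bool) :
    0 < seqLik f θ h := Finset.prod_pos fun _ _ => lossLik_pos _ _ _ _

theorem netWeight_pos (hN : N.Nonempty) (h : Fin t → 𝒳 × Fin K × Bool) :
    0 < netWeight f N h := Finset.sum_pos (fun _ _ => seqLik_pos _ _) hN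

theorem netPredict_pos (hN : N.Nonempty) (h : Fin t → 𝒳 × Fin K × Bool) (x : 𝒳) (a : Fin K)
    (y : Bool) : 0 < netPredict f N h x a y :=
  div_pos (Finset.sum_pos (fun _ _ => mul_pos (seqLik_pos _ _) (lossLik_pos _ _ _ _)) hN)
    (netWeight_pos hN h)

theorem netPredict_false (hN : N.Nonempty) (h : Fin t → 𝒳 × Fin K × Bool) (x : 𝒳) (a : Fin K) :
    netPredict f N h x a false = 1 - netPredict f N h x a true := by
  rw [eq_sub_iff_add_eq, netPredict, netPredict, ← add_div, ← Finset.sum_add_distrib,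
    div_eq_one_iff_eq (netWeight_pos hN h).ne']
  refine Finset.sum_congr rfl fun c _ => ?_
  rw [lossLik_true, lossLik_false]
  ring

theorem netPredict_true_mem_Ioo (hN : N.Nonempty) (h : Fin t → 𝒳 × Fin K × Bool) (x : 𝒳)
    (a : Fin K) : netPredict f N h x a true ∈ Set.Ioo (0 : ℝ) 1 := by
  have := netPredict_pos (f := f) hN h x a false
  rw [netPredict_false hN] at this
  exact ⟨netPredict_pos hN h x a true, by linarith⟩

/-- A mixture of likelihoods that are close to that of `θ` is close to it. -/
theorem abs_log_lossLik_sub_log_netPredict_le (hN : N.Nonempty) {θ : EuclideanSpace ℝ (Fin d)}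
    {x : 𝒳} {a : Fin K} {M : ℝ} (hM : ∀ c ∈ N, |f θ x a - f c x a| ≤ M)
    (h : Fin t → 𝒳 × Fin K × Bool) (y : Bool) :
    |Real.log (lossLik f θ x a y) - Real.log (netPredict f N h x a y)| ≤ M := by
  have hθ := lossLik_pos (f := f) θ x a y
  have hp := netPredict_pos (f := f) hN h x a y
  have hW := netWeight_pos (f := f) hN h
  have h1 : lossLik f θ x a y ≤ Real.exp M * netPredict f N h x a y := by
    rw [netPredict, mul_div_assoc', le_div_iff₀ hW, netWeight, Finset.mul_sum, Finset.mul_sum]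
    refine Finset.sum_le_sum fun c hc => ?_
    have := mul_le_mul_of_nonneg_left (lossLik_le_exp_mul (hM c hc) y) (seqLik_pos (f := f) c h).le
    linarith
  have h2 : netPredict f N h x a y ≤ Real.exp M * lossLik f θ x a y := by
    rw [netPredict, div_le_iff₀ hW, netWeight, Finset.mul_sum]
    refine Finset.sum_le_sum fun c hc => ?_
    have := mul_le_mul_of_nonneg_left (lossLik_le_exp_mul (θ := c) (c := θ)
      (abs_sub_comm (f θ x a) _ ▸ hM c hc) y) (seqLik_pos (f := f) c h).le
    linarith
  have h1' := Real.log_le_log hθ h1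
  have h2' := Real.log_le_log hp h2
  rw [Real.log_mul (Real.exp_pos _).ne' hp.ne', Real.log_exp] at h1'
  rw [Real.log_mul (Real.exp_pos _).ne' hθ.ne', Real.log_exp] at h2'
  exact abs_sub_le_iff.2 ⟨by linarith, by linarith⟩

theorem log_seqLik_sub_log_seqLik_le {θ c : EuclideanSpace ℝ (Fin d)} {δ : ℝ}
    (hδ : ∀ x a, |f θ x a - f c x a| ≤ δ) (h : Fin t → 𝒳 × Fin K × Bool) :
    Real.log (seqLik f θ h) - Real.log (seqLik f c h) ≤ t * δ := by
  rw [seqLik, seqLik, Real.log_prod fun _ _ => (lossLik_pos _ _ _ _).ne',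
    Real.log_prod fun _ _ => (lossLik_pos _ _ _ _).ne', ← Finset.sum_sub_distrib]
  calc _ ≤ ∑ _s : Fin t, δ := Finset.sum_le_sum fun s _ => by
        have := Real.log_le_log (lossLik_pos _ _ _ _)
          (lossLik_le_exp_mul (hδ (h s).1 (h s).2.1) (h s).2.2)
        rw [Real.log_mul (Real.exp_pos _).ne' (lossLik_pos _ _ _ _).ne', Real.log_exp] at this
        linarith
    _ = t * δ := by simp

variable {Ω : Type*} {X : ℕ → Ω → 𝒳} {A : ℕ → Ω → Fin K} {L : ℕ → Ω → Bool}

theorem seqLik_history_succ (θ : EuclideanSpace ℝ (Fin d)) (t : ℕ) (ω : Ω) :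
    seqLik f θ (history X A L (t + 1) ω)
      = seqLik f θ (history X A L t ω) * lossLik f θ (X t ω) (A t ω) (L t ω) := by
  simp [seqLik, history, Fin.prod_univ_castSucc]

theorem netWeight_history_succ (hN : N.Nonempty) (t : ℕ) (ω : Ω) :
    netWeight f N (history X A L (t + 1) ω) = netWeight f N (history X A L t ω)
      * netPredict f N (history X A L t ω) (X t ω) (A t ω) (L t ω) := by
  rw [netPredict, mul_div_cancel₀ _ (netWeight_pos hN _).ne', netWeight]
  exact Finset.sum_congr rfl fun c _ => seqLik_history_succ c t ω

/-- The excess log-losses telescope, as the predictive probabilities are the ratios of successive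
mixture likelihoods. -/
theorem sum_log_sub_log_netPredict (hN : N.Nonempty) (θ : EuclideanSpace ℝ (Fin d)) (T : ℕ)
    (ω : Ω) :
    ∑ t ∈ Finset.range T, (Real.log (lossLik f θ (X t ω) (A t ω) (L t ω))
        - Real.log (netPredict f N (history X A L t ω) (X t ω) (A t ω) (L t ω)))
      = Real.log (seqLik f θ (history X A L T ω)) - Real.log (netWeight f N (history X A L T ω))
        + Real.log N.card := by
  induction T with
  | zero => simp [seqLik, netWeight]
  | succ T ih =>
    rw [Finset.sum_range_succ, ih, seqLik_history_succ, netWeight_history_succ hN,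
      Real.log_mul (seqLik_pos _ _).ne' (lossLik_pos _ _ _ _).ne',
      Real.log_mul (netWeight_pos hN _).ne' (netPredict_pos hN _ _ _ _).ne']
    ring

/-- The cumulative excess log-loss of the mixture over a net: the logarithm of the size of the net,
and the excess log-loss of the point of the net closest to `θ`. -/
theorem sum_log_sub_log_netPredict_le {θ c : EuclideanSpace ℝ (Fin d)} (hc : c ∈ N) {δ : ℝ}
    (hδ : ∀ x a, |f θ x a - f c x a| ≤ δ) (T : ℕ) (ω : Ω) :
    ∑ t ∈ Finset.range T, (Real.log (lossLik f θ (X t ω) (A t ω) (L t ω))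
        - Real.log (netPredict f N (history X A L t ω) (X t ω) (A t ω) (L t ω)))
      ≤ Real.log N.card + T * δ := by
  rw [sum_log_sub_log_netPredict ⟨c, hc⟩]
  have h1 := log_seqLik_sub_log_seqLik_le hδ (history X A L T ω)
  have h2 : Real.log (seqLik f c (history X A L T ω))
      ≤ Real.log (netWeight f N (history X A L T ω)) :=
    Real.log_le_log (seqLik_pos _ _)
      (Finset.single_le_sum (f := fun c => seqLik f c (history X A L T ω))
        (fun _ _ => (seqLik_pos _ _).le) hc)
  linarith

theorem measurable_meanLoss [MeasurableSpace 𝒳]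
    (hfm : ∀ a, Measurable fun p : EuclideanSpace ℝ (Fin d) × 𝒳 => f p.1 p.2 a) (a : Fin K) :
    Measurable fun p : EuclideanSpace ℝ (Fin d) × 𝒳 => meanLoss f p.1 p.2 a :=
  continuous_sigmoid.measurable.comp (hfm a)

theorem measurable_lossLik [MeasurableSpace 𝒳]
    (hfm : ∀ a, Measurable fun p : EuclideanSpace ℝ (Fin d) × 𝒳 => f p.1 p.2 a)
    (c : EuclideanSpace ℝ (Fin d)) :
    Measurable fun p : 𝒳 × Fin K × Bool => lossLik f c p.1 p.2.1 p.2.2 := by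
  have h : ∀ ay : Fin K × Bool, Measurable fun x : 𝒳 => lossLik f c x ay.1 ay.2 := by
    rintro ⟨a, y⟩
    have hx : Measurable fun x : 𝒳 => meanLoss f c x a :=
      (measurable_meanLoss hfm a).comp measurable_prodMk_left
    cases y
    · simpa only [lossLik_false] using hx.const_sub 1
    · simpa only [lossLik_true] using hx
  exact measurable_from_prod_countable_left h

theorem measurable_seqLik [MeasurableSpace 𝒳]
    (hfm : ∀ a, Measurable fun p : EuclideanSpace ℝ (Fin d) × 𝒳 => f p.1 p.2 a)
    (c : EuclideanSpace ℝ (Fin d)) (t : ℕ) :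
    Measurable fun h : Fin t → 𝒳 × Fin K × Bool => seqLik f c h :=
  Finset.measurable_prod _ fun s _ => (measurable_lossLik hfm c).comp (measurable_pi_apply s)

theorem measurable_netPredict [MeasurableSpace 𝒳]
    (hfm : ∀ a, Measurable fun p : EuclideanSpace ℝ (Fin d) × 𝒳 => f p.1 p.2 a)
    (N : Finset (EuclideanSpace ℝ (Fin d))) (t : ℕ) (a : Fin K) (y : Bool) :
    Measurable fun z : (Fin t → 𝒳 × Fin K × Bool) × 𝒳 => netPredict f N z.1 z.2 a y := by
  refine Measurable.div (Finset.measurable_sum _ fun c _ => ?_)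
    (Finset.measurable_sum _ fun c _ => (measurable_seqLik hfm c t).comp measurable_fst)
  exact ((measurable_seqLik hfm c t).comp measurable_fst).mul
    ((measurable_lossLik hfm c).comp
      (measurable_snd.prodMk (measurable_const (a := ((a, y) : Fin K × Bool)))))

end

/-! ### The bandit -/

/-- A net fine enough that over `T` rounds the log-likelihood of its points approximates that of
any parameter up to `1`. -/
theorem exists_net_log_card_le {d : ℕ} (T : ℕ) {S : ℝ} (C : NNReal)
    {Θ : Set (EuclideanSpace ℝ (Fin d))} (hne : Θ.Nonempty) (hΘ : ∀ θ ∈ Θ, ‖θ‖ ≤ S) :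
    ∃ N : Finset (EuclideanSpace ℝ (Fin d)), N.Nonempty ∧ (∀ c ∈ N, c ∈ Θ) ∧
      (∀ θ ∈ Θ, ∃ c ∈ N, (T : ℝ) * (C * dist θ c) ≤ 1) ∧
      Real.log N.card ≤ d * Real.log (2 * S * C * T + 1) := by
  obtain ⟨θ₀, hθ₀⟩ := hne
  have hS : 0 ≤ S := (norm_nonneg _).trans (hΘ θ₀ hθ₀)
  rcases (mul_nonneg C.2 (Nat.cast_nonneg T) : (0 : ℝ) ≤ C * T).eq_or_lt with h0 | hpos
  -- if `C T = 0`, any single point will do; otherwise the radius of the net is `1 / (C T)`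
  · refine ⟨{θ₀}, Finset.singleton_nonempty _, by simpa using hθ₀,
      fun θ _ => ⟨θ₀, Finset.mem_singleton_self _, ?_⟩, ?_⟩
    · calc (T : ℝ) * (C * dist θ θ₀) = C * T * dist θ θ₀ := by ring
        _ ≤ 1 := by rw [← h0, zero_mul]; exact zero_le_one
    · rw [mul_assoc, ← h0]
      simp
  · obtain ⟨N, hNΘ, hcov, hcard⟩ := exists_finset_net hS (one_div_pos.2 hpos) Θ hΘ
    obtain ⟨c₀, hc₀, -⟩ := hcov θ₀ hθ₀
    refine ⟨N, ⟨c₀, hc₀⟩, hNΘ, fun θ hθ => ?_, ?_⟩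
    · obtain ⟨c, hc, hd⟩ := hcov θ hθ
      refine ⟨c, hc, ?_⟩
      rw [le_div_iff₀ hpos] at hd
      linarith
    · have hN : (0 : ℝ) < N.card := Nat.cast_pos.2 (Finset.card_pos.2 ⟨c₀, hc₀⟩)
      refine (Real.log_le_log hN hcard).trans_eq ?_
      rw [Real.log_pow, div_div_eq_mul_div, div_one]
      ring_nf

section

variable {Ω 𝒳 : Type*} [MeasurableSpace Ω] [MeasurableSpace 𝒳] {P : Measure Ω}
  {d K T : ℕ} {Q₁ : Measure (EuclideanSpace ℝ (Fin d))}
  {f : EuclideanSpace ℝ (Fin d) → 𝒳 → Fin K → ℝ} {θs : Ω → EuclideanSpace ℝ (Fin d)}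
  {X : ℕ → Ω → 𝒳} {A : ℕ → Ω → Fin K} {L : ℕ → Ω → Bool}
  {θ : ℕ → Ω → EuclideanSpace ℝ (Fin d)} {Astar : ℕ → Ω → Fin K}

theorem IsEnvironment.measurable_history (henv : IsEnvironment P Q₁ f T θs X A L) {t : ℕ}
    (ht : t ≤ T) : Measurable (history X A L t) :=
  measurable_pi_iff.2 fun s =>
    (henv.measurable_context s (s.2.trans_le ht)).prodMk
      ((henv.measurable_action s (s.2.trans_le ht)).prodMk
        (henv.measurable_loss s (s.2.trans_le ht)))

variable [IsProbabilityMeasure P]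

theorem IsEnvironment.integrable_regret (henv : IsEnvironment P Q₁ f T θs X A L)
    (hfm : ∀ a, Measurable fun p : EuclideanSpace ℝ (Fin d) × 𝒳 => f p.1 p.2 a)
    {t : ℕ} (ht : t < T)
    (hAstar : ∀ᵐ ω ∂P, IsOptimalAction f (θs ω) (X t ω) (Astar t ω)) :
    Integrable (fun ω => meanLoss f (θs ω) (X t ω) (A t ω)
      - meanLoss f (θs ω) (X t ω) (Astar t ω)) P := by
  have hl : ∀ a, Measurable fun p : 𝒳 × EuclideanSpace ℝ (Fin d) => meanLoss f p.2 p.1 a :=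
    fun a => (measurable_meanLoss hfm a).comp measurable_swap
  have hl01 : ∀ (p : 𝒳 × EuclideanSpace ℝ (Fin d)) a,
      meanLoss f p.2 p.1 a ∈ Set.Icc (0 : ℝ) 1 :=
    fun p a => Set.Ioo_subset_Icc_self (meanLoss_mem_Ioo f _ _ _)
  exact (integrable_loss_action (henv.measurable_context t ht) henv.measurable_param
    (henv.measurable_action t ht) hl hl01).sub
    (integrable_loss_optimal (henv.measurable_context t ht) henv.measurable_param hl hl01 hAstar)

/-- The regret of Thompson sampling in one round, in terms of the error of the mixture over any
net. -/
theorem IsThompsonSampling.regret_le (hTS : IsThompsonSampling P f T θs X A L θ)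
    (henv : IsEnvironment P Q₁ f T θs X A L)
    (hfm : ∀ a, Measurable fun p : EuclideanSpace ℝ (Fin d) × 𝒳 => f p.1 p.2 a)
    {N : Finset (EuclideanSpace ℝ (Fin d))} (hN : N.Nonempty) {t : ℕ} (ht : t < T)
    (hAstar : ∀ᵐ ω ∂P, IsOptimalAction f (θs ω) (X t ω) (Astar t ω)) {c : ℝ} (hc : 0 < c) :
    ∫ ω, (meanLoss f (θs ω) (X t ω) (A t ω) - meanLoss f (θs ω) (X t ω) (Astar t ω)) ∂P
      ≤ (K + 1) / (2 * c) + c * ∫ ω, (meanLoss f (θs ω) (X t ω) (A t ω)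
        - netPredict f N (history X A L t ω) (X t ω) (A t ω) true) ^ 2 ∂P := by
  have hH := henv.measurable_history ht.le
  have hX := henv.measurable_context t ht
  refine round_regret_le (Z := fun ω => (history X A L t ω, X t ω)) (θt := θ t)
    (l := fun p a => meanLoss f p.2 p.1.2 a) (g := fun z a => netPredict f N z.1 z.2 a true)
    (hH.prodMk hX) henv.measurable_param (hTS.measurable_sample t ht)
    (henv.measurable_action t ht)
    (map_param_eq_map_sample hH hX henv.measurable_param (hTS.measurable_sample t ht)
      (henv.context t ht) (hTS.sample t ht)) (fun a => ?_)
    (fun a => (measurable_meanLoss hfm a).comp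
      (measurable_snd.prodMk (measurable_snd.comp measurable_fst)))
    (fun p a => Set.Ioo_subset_Icc_self (meanLoss_mem_Ioo f _ _ _))
    (fun a => measurable_netPredict hfm N t a true)
    (fun z a => Set.Ioo_subset_Icc_self (netPredict_true_mem_Ioo hN _ _ _))
    (hTS.action t ht) hAstar hc
  have hpre : (fun ω => (θ t ω, A t ω)) ⁻¹' (Set.univ ×ˢ {a}) = A t ⁻¹' {a} := by
    ext ω; simp
  simpa only [hpre] using hTS.private_randomness t ht (Set.univ ×ˢ {a})
    (MeasurableSet.univ.prod (measurableSet_singleton a))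

/-- In every round, the mean squared error of the mixture is at most half its mean excess
log-loss. The logits may be unbounded; the bound `M` on their differences makes the excess log-loss
integrable. -/
theorem IsEnvironment.sq_error_le (henv : IsEnvironment P Q₁ f T θs X A L)
    (hfm : ∀ a, Measurable fun p : EuclideanSpace ℝ (Fin d) × 𝒳 => f p.1 p.2 a)
    {N : Finset (EuclideanSpace ℝ (Fin d))} (hN : N.Nonempty) {M : ℝ}
    (hM : ∀ᵐ ω ∂P, ∀ c ∈ N, ∀ x a, |f (θs ω) x a - f c x a| ≤ M) {t : ℕ} (ht : t < T) :
    Integrable (fun ω => Real.log (lossLik f (θs ω) (X t ω) (A t ω) (L t ω))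
      - Real.log (netPredict f N (history X A L t ω) (X t ω) (A t ω) (L t ω))) P ∧
    2 * ∫ ω, (meanLoss f (θs ω) (X t ω) (A t ω)
        - netPredict f N (history X A L t ω) (X t ω) (A t ω) true) ^ 2 ∂P
      ≤ ∫ ω, (Real.log (lossLik f (θs ω) (X t ω) (A t ω) (L t ω))
        - Real.log (netPredict f N (history X A L t ω) (X t ω) (A t ω) (L t ω))) ∂P := by
  have hH := henv.measurable_history ht.le
  have hX := henv.measurable_context t ht
  have hA := henv.measurable_action t ht
  have hY : Measurable fun ω => (θs ω, history X A L t ω, X t ω, A t ω) :=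
    henv.measurable_param.prodMk (hH.prodMk (hX.prodMk hA))
  have hp : Measurable fun y : EuclideanSpace ℝ (Fin d) × (Fin t → 𝒳 × Fin K × Bool) × 𝒳 × Fin K =>
      meanLoss f y.1 y.2.2.1 y.2.2.2 :=
    measurable_comp_action (measurable_meanLoss hfm)
      (Y := fun y : EuclideanSpace ℝ (Fin d) × (Fin t → 𝒳 × Fin K × Bool) × 𝒳 × Fin K =>
        (y.1, y.2.2.1)) (by fun_prop) (by fun_prop)
  have hq : Measurable fun y : EuclideanSpace ℝ (Fin d) × (Fin t → 𝒳 × Fin K × Bool) × 𝒳 × Fin K =>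
      netPredict f N y.2.1 y.2.2.1 y.2.2.2 true :=
    measurable_comp_action (fun a => measurable_netPredict hfm N t a true)
      (Y := fun y : EuclideanSpace ℝ (Fin d) × (Fin t → 𝒳 × Fin K × Bool) × 𝒳 × Fin K =>
        (y.2.1, y.2.2.1)) (by fun_prop) (by fun_prop)
  have hpY := hp.comp (comap_measurable fun ω => (θs ω, history X A L t ω, X t ω, A t ω))
  have hqY := hq.comp (comap_measurable fun ω => (θs ω, history X A L t ω, X t ω, A t ω))
  refine two_mul_integral_sq_le_integral_log (henv.measurable_loss t ht) hY.comap_le hpY hqY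
    (fun ω => meanLoss_mem_Ioo f _ _ _) (fun ω => netPredict_true_mem_Ioo hN _ _ _)
    (henv.loss t ht) (C := M) ?_ ?_ ?_
  · filter_upwards [hM] with ω hω
    have := abs_log_lossLik_sub_log_netPredict_le hN (fun c hc => hω c hc (X t ω) (A t ω))
      (history X A L t ω) true
    rwa [lossLik_true] at this
  · filter_upwards [hM] with ω hω
    have := abs_log_lossLik_sub_log_netPredict_le hN (fun c hc => hω c hc (X t ω) (A t ω))
      (history X A L t ω) false
    rwa [lossLik_false, netPredict_false hN] at this
  · intro ω
    cases L t ω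
    · rw [lossLik_false, netPredict_false hN, if_neg Bool.false_ne_true]
      rfl
    · rw [lossLik_true, if_pos rfl]
      rfl

/-- The squared errors of the mixture over a net, summed over the rounds. -/
theorem IsEnvironment.sum_sq_error_le (henv : IsEnvironment P Q₁ f T θs X A L)
    (hfm : ∀ a, Measurable fun p : EuclideanSpace ℝ (Fin d) × 𝒳 => f p.1 p.2 a)
    {S : ℝ} {C : NNReal} {Θ : Set (EuclideanSpace ℝ (Fin d))} (hS : ∀ θ ∈ Θ, ‖θ‖ ≤ S)
    (hΘ : ∀ᵐ ω ∂P, θs ω ∈ Θ) (hfC : ∀ x a, LipschitzOnWith C (fun θ => f θ x a) Θ)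
    {N : Finset (EuclideanSpace ℝ (Fin d))} (hN : N.Nonempty) (hNΘ : ∀ c ∈ N, c ∈ Θ)
    (hcov : ∀ θ ∈ Θ, ∃ c ∈ N, (T : ℝ) * (C * dist θ c) ≤ 1) :
    2 * ∑ t ∈ Finset.range T, ∫ ω, (meanLoss f (θs ω) (X t ω) (A t ω)
        - netPredict f N (history X A L t ω) (X t ω) (A t ω) true) ^ 2 ∂P
      ≤ Real.log N.card + 1 := by
  have hlip : ∀ θ ∈ Θ, ∀ c ∈ N, ∀ x a, |f θ x a - f c x a| ≤ C * dist θ c :=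
    fun θ hθ c hc x a => (hfC x a).dist_le_mul θ hθ c (hNΘ c hc)
  have hM : ∀ᵐ ω ∂P, ∀ c ∈ N, ∀ x a, |f (θs ω) x a - f c x a| ≤ C * (S + S) := by
    filter_upwards [hΘ] with ω hω c hc x a
    refine (hlip _ hω c hc x a).trans (mul_le_mul_of_nonneg_left ?_ C.2)
    exact (dist_le_norm_add_norm _ _).trans (add_le_add (hS _ hω) (hS _ (hNΘ c hc)))
  have hround := fun t (ht : t ∈ Finset.range T) =>
    henv.sq_error_le hfm hN hM (Finset.mem_range.1 ht)
  calc _ ≤ ∑ t ∈ Finset.range T,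
        ∫ ω, (Real.log (lossLik f (θs ω) (X t ω) (A t ω) (L t ω))
          - Real.log (netPredict f N (history X A L t ω) (X t ω) (A t ω) (L t ω))) ∂P := by
        rw [Finset.mul_sum]
        exact Finset.sum_le_sum fun t ht => (hround t ht).2
    _ = ∫ ω, ∑ t ∈ Finset.range T, (Real.log (lossLik f (θs ω) (X t ω) (A t ω) (L t ω))
          - Real.log (netPredict f N (history X A L t ω) (X t ω) (A t ω) (L t ω))) ∂P :=
        (integral_finsetSum _ fun t ht => (hround t ht).1).symm
    _ ≤ ∫ _, (Real.log N.card + 1) ∂P := by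
        refine integral_mono_ae (integrable_finsetSum _ fun t ht => (hround t ht).1)
          (integrable_const _) ?_
        filter_upwards [hΘ] with ω hω
        obtain ⟨c, hc, hle⟩ := hcov _ hω
        exact (sum_log_sub_log_netPredict_le hc (hlip _ hω c hc) T ω).trans
          (add_le_add le_rfl hle)
    _ = Real.log N.card + 1 := by simp

end

end LogisticBandit

end

theorem mainTheorem4 {Ω 𝒳 : Type*} [MeasurableSpace Ω] [MeasurableSpace 𝒳]
    (P : Measure Ω) [IsProbabilityMeasure P] (d K T : ℕ) (S : ℝ) (C : NNReal)
    -- the prior, concentrated on a set `Θ₁` in the centred ball of radius `S`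
    (Q₁ : Measure (EuclideanSpace ℝ (Fin d))) (Θ₁ : Set (EuclideanSpace ℝ (Fin d)))
    (hQ₁ : ∀ᵐ θ ∂Q₁, θ ∈ Θ₁) (hS : ∀ θ ∈ Θ₁, ‖θ‖ ≤ S)
    -- the logit function
    (f : EuclideanSpace ℝ (Fin d) → 𝒳 → Fin K → ℝ)
    (hfm : ∀ a, Measurable fun p : EuclideanSpace ℝ (Fin d) × 𝒳 => f p.1 p.2 a)
    (hfC : ∀ x a, LipschitzOnWith C (fun θ => f θ x a) Θ₁)
    -- hidden parameter, contexts, actions, losses, posterior samples and optimal actions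
    (θs : Ω → EuclideanSpace ℝ (Fin d)) (X : ℕ → Ω → 𝒳) (A : ℕ → Ω → Fin K)
    (L : ℕ → Ω → Bool) (θ : ℕ → Ω → EuclideanSpace ℝ (Fin d)) (Astar : ℕ → Ω → Fin K)
    (henv : LogisticBandit.IsEnvironment P Q₁ f T θs X A L)
    (hTS : LogisticBandit.IsThompsonSampling P f T θs X A L θ)
    (hAstar : ∀ t < T, ∀ᵐ ω ∂P,
      LogisticBandit.IsOptimalAction f (θs ω) (X t ω) (Astar t ω)) :
    LogisticBandit.bayesRegret P f T θs X A Astar ≤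
      Real.sqrt (2 * (K : ℝ) * (T : ℝ) *
        ((d : ℝ) * Real.log (2 * S * (C : ℝ) * (T : ℝ) + 1) + 1)) := by
  rcases Nat.eq_zero_or_pos T with rfl | hT
  · simp [LogisticBandit.bayesRegret]
  have hΘ : ∀ᵐ ω ∂P, θs ω ∈ Θ₁ := by
    rw [← henv.law_param] at hQ₁
    exact ae_of_ae_map henv.measurable_param.aemeasurable hQ₁
  obtain ⟨ω₀, hω₀⟩ := hΘ.exists
  have hS0 : 0 ≤ S := (norm_nonneg _).trans (hS _ hω₀)
  have hK : (1 : ℝ) ≤ K := Nat.one_le_cast.2 (Fin.pos (A 0 ω₀))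
  obtain ⟨N, hN, hNΘ, hcov, hcard⟩ :=
    LogisticBandit.exists_net_log_card_le T C ⟨_, hω₀⟩ hS
  have herr := henv.sum_sq_error_le hfm hS hΘ hfC hN hNΘ hcov
  set B : ℝ := (d : ℝ) * Real.log (2 * S * (C : ℝ) * (T : ℝ) + 1) + 1 with hB
  have hB0 : 0 < B := by
    have : 0 ≤ Real.log (2 * S * (C : ℝ) * (T : ℝ) + 1) := Real.log_nonneg (by
      have : 0 ≤ 2 * S * (C : ℝ) * (T : ℝ) := by positivity
      linarith)
    positivity
  have hT0 : (0 : ℝ) < T := Nat.cast_pos.2 hT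
  set s : ℝ := Real.sqrt (2 * (K : ℝ) * (T : ℝ) * B) with hs
  have hs0 : 0 < s := Real.sqrt_pos.2 (by positivity)
  have hs2 : s ^ 2 = 2 * (K : ℝ) * (T : ℝ) * B := Real.sq_sqrt (by positivity)
  -- `c = s / B` balances the two terms of the bound on the regret of a round
  have hc : 0 < s / B := div_pos hs0 hB0
  have hregret : LogisticBandit.bayesRegret P f T θs X A Astar
      ≤ T * ((K + 1) / (2 * (s / B))) + s / B * (B / 2) := by
    rw [LogisticBandit.bayesRegret, integral_finsetSum _ fun t ht =>
      henv.integrable_regret hfm (Finset.mem_range.1 ht) (hAstar t (Finset.mem_range.1 ht))]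
    refine (Finset.sum_le_sum fun t ht => hTS.regret_le henv hfm hN (Finset.mem_range.1 ht)
      (hAstar t (Finset.mem_range.1 ht)) hc).trans ?_
    rw [Finset.sum_add_distrib, ← Finset.mul_sum, Finset.sum_const, Finset.card_range,
      nsmul_eq_mul]
    exact add_le_add le_rfl (mul_le_mul_of_nonneg_left (by linarith) hc.le)
  refine hregret.trans ?_
  calc (T : ℝ) * ((K + 1) / (2 * (s / B))) + s / B * (B / 2)
      ≤ T * ((K + K) / (2 * (s / B))) + s / B * (B / 2) := by gcongr
    _ = s ^ 2 / (2 * s) + s / 2 := by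
        rw [hs2]
        field_simp
        ring
    _ = s := by field_simp; ring
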